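/- For $j=1,2$ let $R_j$ be the $j$-th component of the Riesz transform on $\mathbb{R}^2$, the Fourier multiplier with symbol $-i\xi_j/|\xi|$, acting on the tempered distributions whose Fourier transform is a function; let $R_1^2=R_1\circ R_1$. Then $R_1^2$ is a bounded negative operator on $L^2(\mathbb{R}^2)$, that is, $-R_1^2$ is self-adjoint and $\langle R_1^2 f,f\rangle_{L^2}\le 0$ for all $f\in L^2(\mathbb{R}^2)$. Nevertheless, there is a non-trivial, non-negative $\tilde W\in L^1(\mathbb{R}^2)$ such that $R_1^2\tilde W$ is a function which is non-negative almost everywhere on the (closed) support of $\tilde W$. Moreover, $\tilde W$ can be chosen such that $\tilde W\notin L^2(\mathbb{R}^2)$; $\tilde W\in L^p(\mathbb{R}^2)$ for some $1<p<2$; $\tilde W$ vanishes outside the cone $$\mathcal{C}=\Big\{(r\cos\theta,r\sin\theta): r>0,\ \tfrac{3\pi}{8}<|\theta|<\tfrac{5\pi}{8}\Big\};$$ and $\tilde W$ is singular at the origin in the sense that $\tilde W\notin L^2(B_\delta(0))$ for every $\delta>0$. -/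

import Mathlib

open MeasureTheory
open scoped SchwartzMap FourierTransform ENNReal

noncomputable section

namespace RieszSquare

/-- The Euclidean plane. -/
abbrev Plane : Type := EuclideanSpace ℝ (Fin 2)

/-- The tempered distribution `T` is the function `f`: every Schwartz function is integrable
against `f`, and `T` is integration against `f`. -/
def Represents (f : Plane → ℂ) (T : 𝓢'(Plane, ℂ)) : Prop :=
  ∀ φ : 𝓢(Plane, ℂ),
    Integrable (fun x => φ x * f x) volume ∧ T φ = ∫ x, φ x * f x

/-- `S` is the `j`-th component of the Riesz transform of `T`: the Fourier transform of `T` is a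
function `m`, and the Fourier transform of `S` is the function `-i (ξ_j / |ξ|) m(ξ)`. -/
def IsRieszTransform (j : Fin 2) (T S : 𝓢'(Plane, ℂ)) : Prop :=
  ∃ m : Plane → ℂ,
    Represents m (𝓕 T) ∧
    Represents (fun ξ => -Complex.I * ((ξ j / ‖ξ‖ : ℝ) : ℂ) * m ξ) (𝓕 S)

/-- `g = R₁² f` for functions `f` and `g` on the plane, where `R₁²` is the composition of the
first component of the Riesz transform (index `0`) with itself. The intermediate object `R₁ f` is
allowed to be a distribution, since `R₁` does not map `L¹` to `L¹`. -/
def IsRieszOneSq (f g : Plane → ℂ) : Prop :=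
  ∃ T U S : 𝓢'(Plane, ℂ),
    Represents f T ∧ IsRieszTransform 0 T U ∧ IsRieszTransform 0 U S ∧ Represents g S

/-- The open double cone `3π/8 < |θ| < 5π/8` around the vertical axis, in polar coordinates. -/
def verticalCone : Set Plane :=
  {x | ∃ r θ : ℝ, 0 < r ∧ 3 * Real.pi / 8 < |θ| ∧ |θ| < 5 * Real.pi / 8 ∧
    x 0 = r * Real.cos θ ∧ x 1 = r * Real.sin θ}

end RieszSquare

end

noncomputable section

namespace RieszSquare

open Filter Module Topology
open scoped LineDeriv Laplacian

/-!
The bump `b z = max (1 - ‖z‖²) 0` is the divergence of an explicit curl-free radial field `v`, so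
that `R₁² b = -∂₁ v₁`. Outside the unit disc this is `(z₁² - z₂²) / (4 ‖z‖⁴)`, which is positive
in horizontal directions, while inside it is at least `-1 / 2`. In `W` a rescaled bump sits on each
disc of a sequence of clusters: the discs of cluster `n` lie at height `2⁻ⁿ` and shrink
horizontally towards the tip `(0, 2⁻ⁿ)`, with masses in a geometric progression of ratio close to
`1`. Every disc of a cluster therefore sees horizontally, near the tip, a mass much larger than its
own, and the positive response of that mass outweighs its own negative response together with those
of the other clusters, which lie at distances comparable to `2⁻ⁿ` or larger and contribute
geometrically little. Since the heights grow almost like `radius⁻²` within each cluster, `W` lies in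
`Lᵖ` only for `p` close to `1`, and it fails to be square integrable near every tip, hence near the
origin.
-/

section Series

variable {α ι E : Type*} [MeasurableSpace α] {μ : Measure α} [Countable ι]
  {p q : ℝ≥0∞}

theorem memLp_tsum [NormedAddCommGroup E] [CompleteSpace E] {F : ι → α → E} (hp : 1 ≤ p)
    (hF : ∀ i, MemLp (F i) p μ) (hsum : ∑' i, eLpNorm (F i) p μ ≠ ∞) :
    MemLp (fun a => ∑' i, F i a) p μ := by
  have : Fact (1 ≤ p) := ⟨hp⟩
  refine (Lp.memLp (∑' i, (hF i).toLp)).ae_eq ?_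
  filter_upwards [Lp.coeFn_tsum (f := fun i => (hF i).toLp) (by simpa [Lp.enorm_toLp] using hsum),
    ae_all_iff.2 fun i => (hF i).coeFn_toLp] with a hseries hcoe
  simp only [hseries, hcoe]

theorem integral_mul_tsum {𝕜 : Type*} [RCLike 𝕜] [p.HolderConjugate q] {h : α → 𝕜}
    {F : ι → α → 𝕜} (hh : MemLp h q μ) (hF : ∀ i, AEStronglyMeasurable (F i) μ)
    (hsum : ∑' i, eLpNorm (F i) p μ ≠ ∞) :
    ∫ a, h a * ∑' i, F i a ∂μ = ∑' i, ∫ a, h a * F i a ∂μ := by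
  have hle (i : ι) : ∫⁻ a, ‖h a * F i a‖ₑ ∂μ ≤ eLpNorm h q μ * eLpNorm (F i) p μ := by
    have : q.HolderConjugate p := .symm
    rw [← eLpNorm_one_eq_lintegral_enorm]
    simpa using eLpNorm_le_eLpNorm_mul_eLpNorm_of_nnnorm (r := 1) hh.1 (hF i) (· * ·) 1
      (.of_forall fun a => by simp)
  simp_rw [← tsum_mul_left]
  refine integral_tsum (fun i => hh.1.mul (hF i))
    (ne_top_of_le_ne_top ?_ (ENNReal.tsum_le_tsum hle))
  rw [ENNReal.tsum_mul_left]
  exact ENNReal.mul_ne_top hh.eLpNorm_ne_top hsum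

end Series

section Superposition

variable {ι E : Type*} [NormedAddCommGroup E] [NormedSpace ℝ E]

/-- The superposition `∑ cᵢ F ((x - yᵢ) / rᵢ)` of copies of `F`, with heights `cᵢ`, moved to the
points `yᵢ` and rescaled to the sizes `rᵢ`. Where the series diverges its value is `0`. -/
def superposition (c r : ι → ℝ) (y : ι → E) (F : E → ℝ) (x : E) : ℝ :=
  ∑' i, c i * F ((r i)⁻¹ • (x - y i))

variable [MeasurableSpace E] [BorelSpace E]

theorem measurableEmbedding_rescale {r : ℝ} (hr : r ≠ 0) (y : E) :
    MeasurableEmbedding fun x => r⁻¹ • (x - y) :=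
  (measurableEmbedding_const_smul₀ (inv_ne_zero hr)).comp (measurableEmbedding_subRight y)

variable [FiniteDimensional ℝ E] {μ : Measure E} [μ.IsAddHaarMeasure] {p : ℝ≥0∞}

theorem map_rescale {r : ℝ} (hr : 0 < r) (y : E) :
    μ.map (fun x => r⁻¹ • (x - y)) = ENNReal.ofReal (r ^ finrank ℝ E) • μ := by
  change μ.map ((r⁻¹ • ·) ∘ (· - y)) = _
  rw [← Measure.map_map (by fun_prop) (by fun_prop),
    (measurePreserving_sub_right μ y).map_eq, Measure.map_addHaar_smul μ (inv_ne_zero hr.ne'),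
    inv_pow, inv_inv, abs_of_pos (by positivity)]

theorem eLpNorm_rescale {G : Type*} [NormedAddCommGroup G] (hp : p ≠ ∞) (F : E → G) {r : ℝ}
    (hr : 0 < r) (y : E) :
    eLpNorm (fun x => F (r⁻¹ • (x - y))) p μ =
      ENNReal.ofReal (r ^ (finrank ℝ E / p.toReal)) * eLpNorm F p μ := by
  have hmap := (measurableEmbedding_rescale hr.ne' y).eLpNorm_map_measure (μ := μ) (p := p) (g := F)
  rw [map_rescale hr, eLpNorm_smul_measure_of_ne_top hp, smul_eq_mul] at hmap
  refine hmap.symm.trans ?_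
  rw [ENNReal.ofReal_rpow_of_nonneg (by positivity) (by positivity), ← Real.rpow_natCast,
    ← Real.rpow_mul hr.le, ENNReal.toReal_div, ENNReal.toReal_one, mul_one_div]

theorem memLp_rescale {G : Type*} [NormedAddCommGroup G] {F : E → G} (hF : MemLp F p μ) {r : ℝ}
    (hr : 0 < r) (y : E) : MemLp (fun x => F (r⁻¹ • (x - y))) p μ := by
  refine (measurableEmbedding_rescale hr.ne' y).memLp_map_measure_iff.1 ?_
  rw [map_rescale hr]
  exact hF.smul_measure ENNReal.ofReal_ne_top

variable {c r : ι → ℝ} {y : ι → E} {F : E → ℝ}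

theorem eLpNorm_const_mul_rescale (hp : p ≠ ∞) (F : E → ℝ) {c r : ℝ} (hc : 0 ≤ c) (hr : 0 < r)
    (y : E) :
    eLpNorm (fun x => c * F (r⁻¹ • (x - y))) p μ =
      ENNReal.ofReal (c * r ^ (finrank ℝ E / p.toReal)) * eLpNorm F p μ := by
  have hsmul := eLpNorm_const_smul c (fun x => F (r⁻¹ • (x - y))) p μ
  rw [eLpNorm_rescale hp F hr, Real.enorm_of_nonneg hc, ← mul_assoc,
    ← ENNReal.ofReal_mul hc] at hsmul
  exact hsmul

theorem tsum_eLpNorm_rescale_ne_top (hp : p ≠ ∞) (hF : MemLp F p μ)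
    (hc : ∀ i, 0 ≤ c i) (hr : ∀ i, 0 < r i)
    (hs : Summable fun i => c i * r i ^ (finrank ℝ E / p.toReal)) :
    ∑' i, eLpNorm (fun x => c i * F ((r i)⁻¹ • (x - y i))) p μ ≠ ∞ := by
  simp_rw [eLpNorm_const_mul_rescale hp F (hc _) (hr _), ENNReal.tsum_mul_right]
  exact ENNReal.mul_ne_top hs.tsum_ofReal_ne_top hF.eLpNorm_ne_top

theorem memLp_superposition [Countable ι] (hp : 1 ≤ p) (hp_top : p ≠ ∞) (hF : MemLp F p μ)
    (hc : ∀ i, 0 ≤ c i) (hr : ∀ i, 0 < r i)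
    (hs : Summable fun i => c i * r i ^ (finrank ℝ E / p.toReal)) :
    MemLp (superposition c r y F) p μ :=
  memLp_tsum hp (fun i => (memLp_rescale hF (hr i) (y i)).const_mul (c i))
    (tsum_eLpNorm_rescale_ne_top hp_top hF hc hr hs)

theorem ae_summable_rescale [Countable ι] (hp : 1 ≤ p) (hp_top : p ≠ ∞) (hF : MemLp F p μ)
    (hc : ∀ i, 0 ≤ c i) (hr : ∀ i, 0 < r i)
    (hs : Summable fun i => c i * r i ^ (finrank ℝ E / p.toReal)) :
    ∀ᵐ x ∂μ, Summable fun i => c i * F ((r i)⁻¹ • (x - y i)) := by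
  filter_upwards [summable_norm_of_tsum_eLpNorm_ne_top hp
    (fun i => ((memLp_rescale hF (hr i) (y i)).const_mul (c i)).1)
    (tsum_eLpNorm_rescale_ne_top hp_top hF hc hr hs)] with x hx using hx.of_norm

theorem le_eLpNorm_superposition [Countable ι] (hp : 1 ≤ p) (hp_top : p ≠ ∞) (hF : MemLp F p μ)
    (hF0 : ∀ x, 0 ≤ F x) (hc : ∀ i, 0 ≤ c i) (hr : ∀ i, 0 < r i)
    (hs : Summable fun i => c i * r i ^ (finrank ℝ E / p.toReal)) {q : ℝ≥0∞} (hq_top : q ≠ ∞)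
    {B : Set E} {i : ι} (hB : ∀ x ∉ B, F ((r i)⁻¹ • (x - y i)) = 0) :
    ENNReal.ofReal (c i * r i ^ (finrank ℝ E / q.toReal)) * eLpNorm F q μ ≤
      eLpNorm (superposition c r y F) q (μ.restrict B) := by
  have hsupp : (Function.support fun x => c i * F ((r i)⁻¹ • (x - y i))) ⊆ B := fun x hx => by
    by_contra hxB
    exact hx (by simp [hB x hxB])
  rw [← eLpNorm_const_mul_rescale hq_top F (hc i) (hr i),
    ← eLpNorm_restrict_eq_of_support_subset hsupp]
  refine eLpNorm_mono_ae (ae_restrict_of_ae ?_)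
  filter_upwards [ae_summable_rescale hp hp_top hF hc hr hs (y := y)] with x hx
  rw [Real.norm_of_nonneg (mul_nonneg (hc i) (hF0 _))]
  exact (hx.le_tsum i fun j _ => mul_nonneg (hc j) (hF0 _)).trans (le_abs_self _)

theorem not_memLp_superposition [Countable ι] (hp : 1 ≤ p) (hp_top : p ≠ ∞) (hF : MemLp F p μ)
    (hF0 : ∀ x, 0 ≤ F x) (hc : ∀ i, 0 ≤ c i) (hr : ∀ i, 0 < r i)
    (hs : Summable fun i => c i * r i ^ (finrank ℝ E / p.toReal)) {q : ℝ≥0∞} (hq_top : q ≠ ∞)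
    (hFq : eLpNorm F q μ ≠ 0) {B : Set E} {s : ℕ → ι}
    (hB : ∀ k, ∀ x ∉ B, F ((r (s k))⁻¹ • (x - y (s k))) = 0)
    (hlim : Tendsto (fun k => c (s k) * r (s k) ^ (finrank ℝ E / q.toReal)) atTop atTop) :
    ¬ MemLp (superposition c r y F) q (μ.restrict B) := by
  intro hmem
  have htop := ENNReal.Tendsto.mul_const (ENNReal.tendsto_ofReal_atTop.comp hlim)
    (.inl ENNReal.top_ne_zero) (b := eLpNorm F q μ)
  rw [ENNReal.top_mul hFq] at htop
  refine hmem.eLpNorm_ne_top (top_le_iff.1 (le_of_tendsto' htop fun k => ?_))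
  exact le_eLpNorm_superposition hp hp_top hF hF0 hc hr hs hq_top (hB k)

end Superposition

section Represents

theorem Represents.congr_ae {f g : Plane → ℂ} {T : 𝓢'(Plane, ℂ)} (hf : Represents f T)
    (hfg : f =ᵐ[volume] g) : Represents g T := by
  intro φ
  have h : (fun x => φ x * f x) =ᵐ[volume] fun x => φ x * g x := by
    filter_upwards [hfg] with x hx using by rw [hx]
  exact ⟨(hf φ).1.congr h, (hf φ).2.trans (integral_congr_ae h)⟩

theorem Represents.locallyIntegrable {f : Plane → ℂ} {T : 𝓢'(Plane, ℂ)} (hf : Represents f T) :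
    LocallyIntegrable f volume := by
  intro x
  let χ : ContDiffBump x := ⟨1, 2, one_pos, one_lt_two⟩
  have hχ : HasCompactSupport fun z => (χ z : ℂ) :=
    χ.hasCompactSupport.comp_left Complex.ofReal_zero
  let φ : 𝓢(Plane, ℂ) := hχ.toSchwartzMap (Complex.ofRealCLM.contDiff.comp χ.contDiff)
  refine ⟨Metric.ball x 1, Metric.ball_mem_nhds x one_pos, ?_⟩
  refine (hf φ).1.integrableOn.congr_fun (fun z hz => ?_) measurableSet_ball
  have hz1 : φ z = 1 := congrArg Complex.ofReal
    (χ.one_of_mem_closedBall (Metric.ball_subset_closedBall hz))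
  change φ z * f z = f z
  rw [hz1, one_mul]

theorem Represents.ae_eq {f g : Plane → ℂ} {T : 𝓢'(Plane, ℂ)} (hf : Represents f T)
    (hg : Represents g T) : f =ᵐ[volume] g := by
  refine ae_eq_of_integral_contDiff_smul_eq hf.locallyIntegrable hg.locallyIntegrable
    fun χ hχ hχc => ?_
  have hχ' : HasCompactSupport fun z => (χ z : ℂ) := hχc.comp_left Complex.ofReal_zero
  let φ : 𝓢(Plane, ℂ) := hχ'.toSchwartzMap (Complex.ofRealCLM.contDiff.comp hχ)
  exact (hf φ).2.symm.trans (hg φ).2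

theorem Represents.neg {f : Plane → ℂ} {T : 𝓢'(Plane, ℂ)} (hf : Represents f T) :
    Represents (fun x => -f x) (-T) := fun φ => by
  simp_rw [mul_neg, integral_neg]
  exact ⟨(hf φ).1.neg, congrArg Neg.neg (hf φ).2⟩

theorem Represents.smulLeftCLM {f h : Plane → ℂ} {T : 𝓢'(Plane, ℂ)} (hf : Represents f T)
    (hh : h.HasTemperateGrowth) :
    Represents (fun x => h x * f x) (TemperedDistribution.smulLeftCLM ℂ h T) := by
  intro φ
  have hφ (x : Plane) : φ x * (h x * f x) = SchwartzMap.smulLeftCLM ℂ h φ x * f x := by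
    rw [SchwartzMap.smulLeftCLM_apply_apply hh, smul_eq_mul]
    ring
  simp_rw [hφ]
  exact hf _

theorem represents_toTemperedDistribution {p : ℝ≥0∞} [hp : Fact (1 ≤ p)]
    (f : Lp ℂ p (volume : Measure Plane)) : Represents f (Lp.toTemperedDistribution f) := by
  intro φ
  have := ENNReal.HolderConjugate.inv_one_sub_inv' hp.out
  have hφ : MemLp φ (1 - p⁻¹)⁻¹ volume := φ.memLp _ _
  exact ⟨memLp_one_iff_integrable.1 ((Lp.memLp f).mul hφ), by simp⟩

theorem exists_represents_of_memLp {p : ℝ≥0∞} [Fact (1 ≤ p)] {f : Plane → ℂ}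
    (hf : MemLp f p volume) : ∃ T : 𝓢'(Plane, ℂ), Represents f T :=
  ⟨_, (represents_toTemperedDistribution hf.toLp).congr_ae hf.coeFn_toLp⟩

theorem represents_fourier_toTemperedDistribution (f : Lp ℂ 2 (volume : Measure Plane)) :
    Represents (𝓕 f : Lp ℂ 2 (volume : Measure Plane)) (𝓕 (Lp.toTemperedDistribution f)) := by
  rw [Lp.fourier_toTemperedDistribution_eq]
  exact represents_toTemperedDistribution _

end Represents

section FourierIntegral

variable {E : Type*} [NormedAddCommGroup E] [InnerProductSpace ℝ E] [FiniteDimensional ℝ E]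
  [MeasurableSpace E] [BorelSpace E]

theorem memLp_top_fourier {f : E → ℂ} (hf : Integrable f) : MemLp (𝓕 f) ∞ :=
  memLp_top_of_bound
    (VectorFourier.fourierIntegral_continuous Real.continuous_fourierChar continuous_inner
      hf).aestronglyMeasurable (∫ x, ‖f x‖)
    (.of_forall fun _ => VectorFourier.norm_fourierIntegral_le_integral_norm _ _ _ _ _)

theorem integral_fourier_mul_comm {f h : E → ℂ} (hf : Integrable f) (hh : Integrable h) :
    ∫ x, 𝓕 h x * f x = ∫ ξ, h ξ * 𝓕 f ξ := by
  simpa using! VectorFourier.integral_bilin_fourierIntegral_eq_flip (.mul ℂ ℂ) (L := innerₗ E)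
    Real.continuous_fourierChar continuous_inner hh hf

theorem represents_fourier_of_integrable {f : Plane → ℂ} {T : 𝓢'(Plane, ℂ)}
    (hf : Integrable f) (hT : Represents f T) : Represents (𝓕 f) (𝓕 T) := by
  intro φ
  have hφ : MemLp φ 1 volume := memLp_one_iff_integrable.2 φ.integrable
  refine ⟨memLp_one_iff_integrable.1 ((memLp_top_fourier hf).mul hφ), ?_⟩
  rw [TemperedDistribution.fourier_apply, (hT _).2, SchwartzMap.fourier_coe,
    integral_fourier_mul_comm hf φ.integrable]

end FourierIntegral

section Symbol

/-- The symbol `-i ξ₁ / |ξ|` of the first component of the Riesz transform. -/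
def rieszSymbol (ξ : Plane) : ℂ := -Complex.I * ((ξ 0 / ‖ξ‖ : ℝ) : ℂ)

theorem norm_rieszSymbol_le (ξ : Plane) : ‖rieszSymbol ξ‖ ≤ 1 := by
  have h : |ξ 0| ≤ ‖ξ‖ := by simpa using PiLp.norm_apply_le ξ 0
  simpa only [rieszSymbol, norm_mul, norm_neg, Complex.norm_I, one_mul, Complex.norm_real,
    Real.norm_eq_abs, abs_div, abs_norm] using div_le_one_of_le₀ h (norm_nonneg _)

theorem measurable_rieszSymbol : Measurable rieszSymbol := by
  unfold rieszSymbol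
  have : Measurable fun ξ : Plane => ξ 0 := by fun_prop
  fun_prop

theorem memLp_top_rieszSymbol : MemLp rieszSymbol ∞ volume :=
  memLp_top_of_bound measurable_rieszSymbol.aestronglyMeasurable 1 (.of_forall norm_rieszSymbol_le)

theorem memLp_rieszSymbol_mul {p : ℝ≥0∞} {f : Plane → ℂ} (hf : MemLp f p volume) :
    MemLp (fun ξ => rieszSymbol ξ * f ξ) p volume :=
  hf.mul memLp_top_rieszSymbol

theorem rieszSymbol_mul_self_mul_norm_sq (ξ : Plane) :
    rieszSymbol ξ * rieszSymbol ξ * (‖ξ‖ ^ 2 : ℝ) = -((ξ 0 ^ 2 : ℝ) : ℂ) := by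
  rcases eq_or_ne ξ 0 with rfl | hξ
  · simp
  · have : (‖ξ‖ : ℂ) ≠ 0 := by simpa using hξ
    simp only [rieszSymbol]
    push_cast
    field_simp
    linear_combination (ξ 0 : ℂ) ^ 2 * Complex.I_sq

theorem isRieszOneSq_of_memLp_fourier {p : ℝ≥0∞} [Fact (1 ≤ p)] {f g m : Plane → ℂ}
    {T S : 𝓢'(Plane, ℂ)} (hf : Represents f T) (hm : Represents m (𝓕 T)) (hmp : MemLp m p volume)
    (hS : Represents (fun ξ => rieszSymbol ξ * (rieszSymbol ξ * m ξ)) (𝓕 S))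
    (hg : Represents g S) : IsRieszOneSq f g := by
  obtain ⟨V, hV⟩ := exists_represents_of_memLp (memLp_rieszSymbol_mul hmp)
  have hV' : Represents (fun ξ => rieszSymbol ξ * m ξ) (𝓕 (𝓕⁻ V)) := by
    rwa [FourierTransform.fourier_fourierInv_eq]
  exact ⟨T, 𝓕⁻ V, S, hf, ⟨m, hm, hV'⟩, ⟨_, hV', hS⟩, hg⟩

end Symbol

section WeakRieszOneSq

/-- The weak form of `g = R₁² f`, with the symbol of `R₁²` moved onto the test function `ψ`. It is
linear in the pair `(f, g)` and, unlike `IsRieszOneSq`, passes to the sum of a series. -/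
def IsWeakRieszOneSq (f g : Plane → ℂ) : Prop :=
  ∀ ψ : 𝓢(Plane, ℂ), Integrable (fun x => ψ x * g x) ∧
    ∫ x, 𝓕 ψ x * g x = ∫ x, 𝓕 (fun ξ => rieszSymbol ξ * (rieszSymbol ξ * ψ ξ)) x * f x

variable {f g : Plane → ℂ}

theorem integrable_rieszSymbol_mul_schwartz (ψ : 𝓢(Plane, ℂ)) :
    Integrable fun ξ => rieszSymbol ξ * (rieszSymbol ξ * ψ ξ) :=
  memLp_one_iff_integrable.1 <| memLp_rieszSymbol_mul <| memLp_rieszSymbol_mul <|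
    memLp_one_iff_integrable.2 ψ.integrable

theorem integral_fourier_rieszSymbol_mul (hf : Integrable f) (ψ : 𝓢(Plane, ℂ)) :
    ∫ x, 𝓕 (fun ξ => rieszSymbol ξ * (rieszSymbol ξ * ψ ξ)) x * f x =
      ∫ ξ, ψ ξ * (rieszSymbol ξ * (rieszSymbol ξ * 𝓕 f ξ)) := by
  rw [integral_fourier_mul_comm hf (integrable_rieszSymbol_mul_schwartz ψ)]
  exact integral_congr_ae (.of_forall fun ξ => by ring)

theorem IsWeakRieszOneSq.isRieszOneSq (hfg : IsWeakRieszOneSq f g) (hf : Integrable f) :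
    IsRieszOneSq f g := by
  obtain ⟨T, hT⟩ := exists_represents_of_memLp (memLp_one_iff_integrable.2 hf)
  obtain ⟨V, hV⟩ := exists_represents_of_memLp
    (memLp_rieszSymbol_mul (memLp_rieszSymbol_mul (memLp_top_fourier hf)))
  have hV' : Represents (fun ξ => rieszSymbol ξ * (rieszSymbol ξ * 𝓕 f ξ)) (𝓕 (𝓕⁻ V)) := by
    rwa [FourierTransform.fourier_fourierInv_eq]
  refine isRieszOneSq_of_memLp_fourier hT (represents_fourier_of_integrable hf hT)
    (memLp_top_fourier hf) hV' fun φ => ⟨(hfg φ).1, ?_⟩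
  rw [TemperedDistribution.fourierInv_apply, (hV _).2, ← integral_fourier_rieszSymbol_mul hf,
    ← (hfg _).2, FourierTransform.fourier_fourierInv_eq]

theorem IsWeakRieszOneSq.const_mul (hfg : IsWeakRieszOneSq f g) (c : ℂ) :
    IsWeakRieszOneSq (fun x => c * f x) (fun x => c * g x) := fun ψ => by
  simp_rw [mul_left_comm _ c, integral_const_mul, (hfg ψ).2, and_true]
  exact (hfg ψ).1.const_mul c

theorem IsWeakRieszOneSq.tsum {ι : Type*} [Countable ι] {p : ℝ≥0∞} {F G : ι → Plane → ℂ}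
    (hFG : ∀ i, IsWeakRieszOneSq (F i) (G i)) (hp : 1 ≤ p)
    (hF : ∀ i, MemLp (F i) 1 volume) (hF_sum : ∑' i, eLpNorm (F i) 1 volume ≠ ∞)
    (hG : ∀ i, MemLp (G i) p volume) (hG_sum : ∑' i, eLpNorm (G i) p volume ≠ ∞) :
    IsWeakRieszOneSq (fun x => ∑' i, F i x) (fun x => ∑' i, G i x) := by
  intro ψ
  have := ENNReal.HolderConjugate.inv_one_sub_inv' hp
  have hψ (φ : 𝓢(Plane, ℂ)) : MemLp φ (1 - p⁻¹)⁻¹ volume := φ.memLp _ _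
  refine ⟨memLp_one_iff_integrable.1 ((memLp_tsum hp hG hG_sum).mul (hψ ψ)), ?_⟩
  rw [integral_mul_tsum (hψ (𝓕 ψ)) (fun i => (hG i).1) hG_sum,
    integral_mul_tsum (memLp_top_fourier (integrable_rieszSymbol_mul_schwartz ψ))
      (fun i => (hF i).1) hF_sum]
  exact tsum_congr fun i => (hFG i ψ).2

end WeakRieszOneSq

section OperatorL2

/-- Multiplication by the symbol of the first Riesz transform, as an operator on `L²`. -/
def rieszMulL2 : Lp ℂ 2 (volume : Measure Plane) →L[ℂ] Lp ℂ 2 (volume : Measure Plane) :=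
  (ContinuousLinearMap.mul ℂ ℂ).holderL volume ∞ 2 2 (memLp_top_rieszSymbol.toLp rieszSymbol)

theorem coeFn_rieszMulL2 (f : Lp ℂ 2 (volume : Measure Plane)) :
    rieszMulL2 f =ᵐ[volume] fun ξ => rieszSymbol ξ * f ξ := by
  refine ((ContinuousLinearMap.mul ℂ ℂ).coeFn_holder _ f).trans ?_
  filter_upwards [memLp_top_rieszSymbol.coeFn_toLp] with ξ hξ
  rw [ContinuousLinearMap.mul_apply', hξ]

theorem inner_rieszMulL2_left (f g : Lp ℂ 2 (volume : Measure Plane)) :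
    inner ℂ (rieszMulL2 f) g = -inner ℂ f (rieszMulL2 g) := by
  rw [L2.inner_def, L2.inner_def, ← integral_neg]
  refine integral_congr_ae ?_
  filter_upwards [coeFn_rieszMulL2 f, coeFn_rieszMulL2 g] with ξ hf hg
  have hconj : star (rieszSymbol ξ) = -rieszSymbol ξ := by simp [rieszSymbol]
  simp only [hf, hg, RCLike.inner_apply', map_mul, starRingEnd_apply, hconj]
  ring

/-- The first Riesz transform on `L²`, followed by the Fourier transform. -/
def fourierRieszL2 : Lp ℂ 2 (volume : Measure Plane) →L[ℂ] Lp ℂ 2 (volume : Measure Plane) :=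
  rieszMulL2 ∘L (Lp.fourierTransformₗᵢ Plane ℂ : _ →L[ℂ] _)

/-- The operator `R₁²` on `L²`. -/
def rieszOneSqL2 : Lp ℂ 2 (volume : Measure Plane) →L[ℂ] Lp ℂ 2 (volume : Measure Plane) :=
  ((Lp.fourierTransformₗᵢ Plane ℂ).symm : _ →L[ℂ] _) ∘L rieszMulL2 ∘L fourierRieszL2

theorem fourier_rieszOneSqL2 (f : Lp ℂ 2 (volume : Measure Plane)) :
    𝓕 (rieszOneSqL2 f) = rieszMulL2 (rieszMulL2 (𝓕 f)) :=
  FourierTransform.fourier_fourierInv_eq _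

theorem isRieszOneSq_rieszOneSqL2 (f : Lp ℂ 2 (volume : Measure Plane)) :
    IsRieszOneSq f (rieszOneSqL2 f) := by
  refine isRieszOneSq_of_memLp_fourier (represents_toTemperedDistribution f)
    (represents_fourier_toTemperedDistribution f) (Lp.memLp _)
    ((represents_fourier_toTemperedDistribution _).congr_ae ?_)
    (represents_toTemperedDistribution _)
  rw [fourier_rieszOneSqL2]
  filter_upwards [coeFn_rieszMulL2 (rieszMulL2 (𝓕 f)), coeFn_rieszMulL2 (𝓕 f)] with ξ h₂ h₁
  rw [h₂, h₁]

theorem neg_rieszOneSqL2_eq_adjoint_comp_self :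
    -rieszOneSqL2 = ContinuousLinearMap.adjoint fourierRieszL2 ∘L fourierRieszL2 := by
  refine ContinuousLinearMap.ext fun f => ext_inner_right ℂ fun g => ?_
  have hRiesz (h : Lp ℂ 2 (volume : Measure Plane)) : fourierRieszL2 h = rieszMulL2 (𝓕 h) := rfl
  rw [ContinuousLinearMap.comp_apply, ContinuousLinearMap.adjoint_inner_left,
    neg_apply, inner_neg_left, ← Lp.inner_fourier_eq, fourier_rieszOneSqL2,
    inner_rieszMulL2_left, neg_neg, hRiesz, hRiesz]

theorem isPositive_neg_rieszOneSqL2 : (-rieszOneSqL2).IsPositive := by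
  rw [neg_rieszOneSqL2_eq_adjoint_comp_self]
  exact ContinuousLinearMap.isPositive_adjoint_comp_self fourierRieszL2

end OperatorL2

section Derivatives

/-- The standard unit vectors of the plane, indexed from `0`. -/
abbrev unitVec (i : Fin 2) : Plane := EuclideanSpace.single i 1

variable {T S : 𝓢'(Plane, ℂ)} {f g m : Plane → ℂ}

theorem Represents.unique (hT : Represents f T) (hS : Represents f S) : T = S := by
  ext φ
  exact (hT φ).2.trans (hS φ).2.symm

theorem Represents.add (hf : Represents f T) (hg : Represents g S) :
    Represents (fun x => f x + g x) (T + S) := fun φ => by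
  simp_rw [mul_add]
  exact ⟨(hf φ).1.add (hg φ).1,
    (congrArg₂ (· + ·) (hf φ).2 (hg φ).2).trans (integral_add (hf φ).1 (hg φ).1).symm⟩

theorem Represents.const_smul (hf : Represents f T) (c : ℂ) :
    Represents (fun x => c * f x) (c • T) := fun φ => by
  simp_rw [mul_left_comm _ c, integral_const_mul]
  exact ⟨(hf φ).1.const_mul c, congrArg (c * ·) (hf φ).2⟩

theorem Represents.lineDerivOp {f' : Plane → ℂ} {a : Plane} (hf : Represents f T)
    (hderiv : ∀ x, HasLineDerivAt ℝ f (f' x) x a)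
    (hf' : ∀ φ : 𝓢(Plane, ℂ), Integrable fun x => φ x * f' x) : Represents f' (∂_{a} T) := by
  intro φ
  have hparts := integral_bilinear_hasLineDerivAt_right_eq_neg_left_of_integrable
    (B := ContinuousLinearMap.mul ℝ ℂ) (f := φ) (f' := (∂_{a} φ : 𝓢(Plane, ℂ))) (g := f) (g' := f')
    (μ := volume) (hf (∂_{a} φ)).1 (hf' φ) (hf φ).1
    (fun x _ => (φ.hasFDerivAt x).hasLineDerivAt a) (fun x _ => hderiv x)
  refine ⟨hf' φ, ?_⟩
  rw [TemperedDistribution.lineDerivOp_apply_apply, map_neg, (hf _).2]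
  exact hparts.symm

theorem Represents.fourier_lineDerivOp (hm : Represents m (𝓕 T)) (a : Plane) :
    Represents (fun ξ => 2 * Real.pi * Complex.I * ((inner ℝ ξ a : ℝ) * m ξ)) (𝓕 (∂_{a} T)) := by
  rw [TemperedDistribution.fourier_lineDerivOp_eq]
  exact (hm.smulLeftCLM (h := fun ξ => (inner ℝ ξ a : ℝ)) (by fun_prop)).const_smul _

theorem Represents.fourier_laplacian (hm : Represents m (𝓕 T)) :
    Represents (fun ξ => (-(2 * Real.pi) ^ 2 : ℝ) * ((‖ξ‖ ^ 2 : ℝ) * m ξ)) (𝓕 (Δ T)) := by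
  rw [TemperedDistribution.laplacian_eq_fourierMultiplierCLM, ← Complex.coe_smul,
    FourierTransform.fourier_smul, TemperedDistribution.fourierMultiplierCLM_apply,
    FourierTransform.fourier_fourierInv_eq]
  exact (hm.smulLeftCLM (h := fun ξ => ((‖ξ‖ ^ 2 : ℝ) : ℂ)) (by fun_prop)).const_smul _

theorem ae_eq_rieszSymbol_mul_of_laplacian_eq {n : Plane → ℂ}
    (h : Δ S = -∂_{unitVec 0} (∂_{unitVec 0} T))
    (hm : Represents m (𝓕 T)) (hn : Represents n (𝓕 S)) :
    n =ᵐ[volume] fun ξ => rieszSymbol ξ * (rieszSymbol ξ * m ξ) := by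
  have hlap := hn.fourier_laplacian
  rw [h, FourierTransform.fourier_neg] at hlap
  filter_upwards [hlap.ae_eq ((hm.fourier_lineDerivOp _).fourier_lineDerivOp _).neg,
    Measure.ae_ne volume (0 : Plane)] with ξ hξ hξ0
  have hnorm : ((‖ξ‖ ^ 2 : ℝ) : ℂ) ≠ 0 := by simpa using hξ0
  have hpi : (-(2 * Real.pi) ^ 2 : ℂ) ≠ 0 := by simp
  simp only [EuclideanSpace.inner_single_right, conj_trivial, one_mul] at hξ
  refine mul_left_cancel₀ hpi (mul_left_cancel₀ hnorm ?_)
  have hsymbol := rieszSymbol_mul_self_mul_norm_sq ξ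
  push_cast at hξ hsymbol ⊢
  linear_combination hξ + 4 * Real.pi ^ 2 * m ξ * hsymbol -
    4 * Real.pi ^ 2 * ξ 0 ^ 2 * m ξ * Complex.I_sq

theorem isWeakRieszOneSq_of_laplacian_eq (hf : Integrable f) (hg : MemLp g 2 volume)
    (hT : Represents f T) (hS : Represents g S)
    (h : Δ S = -∂_{unitVec 0} (∂_{unitVec 0} T)) : IsWeakRieszOneSq f g := by
  obtain rfl := hS.unique ((represents_toTemperedDistribution _).congr_ae hg.coeFn_toLp)
  have hn := represents_fourier_toTemperedDistribution hg.toLp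
  have hfourier := hn.congr_ae
    (ae_eq_rieszSymbol_mul_of_laplacian_eq h (represents_fourier_of_integrable hf hT) hn)
  intro ψ
  rw [← (hS _).2, integral_fourier_rieszSymbol_mul hf, ← (hfourier ψ).2,
    TemperedDistribution.fourier_apply]
  exact ⟨(hS ψ).1, rfl⟩

theorem lineDerivOp_comm {E F : Type*} [NormedAddCommGroup E] [InnerProductSpace ℝ E]
    [FiniteDimensional ℝ E] [MeasurableSpace E] [BorelSpace E] [NormedAddCommGroup F]
    [NormedSpace ℂ F] (a b : E) (T : 𝓢'(E, F)) : ∂_{a} (∂_{b} T) = ∂_{b} (∂_{a} T) := by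
  simp only [TemperedDistribution.lineDeriv_eq_fourierMultiplierCLM, map_smul]
  rw [TemperedDistribution.fourierMultiplierCLM_fourierMultiplierCLM_apply (by fun_prop)
    (by fun_prop), TemperedDistribution.fourierMultiplierCLM_fourierMultiplierCLM_apply
    (by fun_prop) (by fun_prop), mul_comm (fun x => ((inner ℝ x a : ℝ) : ℂ))]

theorem laplacian_lineDerivOp_of_curl_eq_zero {V : Fin 2 → 𝓢'(Plane, ℂ)}
    (h : ∂_{unitVec 0} (V 1) = ∂_{unitVec 1} (V 0)) :
    Δ (∂_{unitVec 0} (V 0)) =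
      ∂_{unitVec 0} (∂_{unitVec 0} (∂_{unitVec 0} (V 0) + ∂_{unitVec 1} (V 1))) := by
  simp only [TemperedDistribution.laplacian_eq_sum (EuclideanSpace.basisFun (Fin 2) ℝ),
    EuclideanSpace.basisFun_apply, Fin.sum_univ_two, LineDeriv.lineDerivOp_add]
  congr 1
  rw [lineDerivOp_comm (unitVec 1) (unitVec 0), ← h, lineDerivOp_comm (unitVec 1) (unitVec 0),
    lineDerivOp_comm (unitVec 1) (unitVec 0)]

end Derivatives

section Bump

/-- The radial factor of the gradient `radialFactor (‖z‖²) z` of a potential with Laplacian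
`max (1 - ‖z‖²) 0`, as a function of `s = ‖z‖²`. -/
def radialFactor (s : ℝ) : ℝ := if s ≤ 1 then 1 / 2 - s / 4 else 1 / (4 * s)

/-- The derivative of `radialFactor`. -/
def radialFactorDeriv (s : ℝ) : ℝ := if s ≤ 1 then -(1 / 4) else -(1 / (4 * s ^ 2))

variable {s : ℝ}

theorem radialFactor_of_le_one (h : s ≤ 1) : radialFactor s = 1 / 2 - s / 4 := if_pos h

theorem radialFactor_of_one_le (h : 1 ≤ s) : radialFactor s = 1 / (4 * s) := by
  rcases h.eq_or_lt with rfl | h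
  · norm_num [radialFactor]
  · exact if_neg h.not_ge

theorem radialFactorDeriv_of_le_one (h : s ≤ 1) : radialFactorDeriv s = -(1 / 4) := if_pos h

theorem radialFactorDeriv_of_one_le (h : 1 ≤ s) :
    radialFactorDeriv s = -(1 / (4 * s ^ 2)) := by
  rcases h.eq_or_lt with rfl | h
  · norm_num [radialFactorDeriv]
  · exact if_neg h.not_ge

theorem hasDerivWithinAt_radialFactor_Iic (s : ℝ) :
    HasDerivWithinAt radialFactor (radialFactorDeriv s) (Set.Iic 1) s := by
  by_cases hs : s ≤ 1
  · rw [radialFactorDeriv_of_le_one hs]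
    have h : HasDerivAt (fun t : ℝ => 1 / 2 - t / 4) (-(1 / 4)) s :=
      ((hasDerivAt_id s).div_const 4).const_sub (1 / 2)
    exact h.hasDerivWithinAt.congr (fun _ ht => radialFactor_of_le_one ht)
      (radialFactor_of_le_one hs)
  · exact hasDerivWithinAt_iff_hasFDerivWithinAt.2 (.of_notMem_closure (by simpa using hs))

theorem hasDerivWithinAt_radialFactor_Ici (s : ℝ) :
    HasDerivWithinAt radialFactor (radialFactorDeriv s) (Set.Ici 1) s := by
  by_cases hs : 1 ≤ s
  · rw [radialFactorDeriv_of_one_le hs]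
    have h : HasDerivAt (fun t : ℝ => 1 / (4 * t)) (-(1 / (4 * s ^ 2))) s := by
      simp only [one_div]
      refine (((hasDerivAt_id s).const_mul 4).fun_inv (by simp; linarith)).congr_deriv ?_
      simp only [id]
      field_simp
    exact h.hasDerivWithinAt.congr (fun _ ht => radialFactor_of_one_le ht)
      (radialFactor_of_one_le hs)
  · exact hasDerivWithinAt_iff_hasFDerivWithinAt.2 (.of_notMem_closure (by simpa using hs))

theorem hasDerivAt_radialFactor (s : ℝ) : HasDerivAt radialFactor (radialFactorDeriv s) s := by
  simpa only [Set.Iic_union_Ici, hasDerivWithinAt_univ] using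
    (hasDerivWithinAt_radialFactor_Iic s).union (hasDerivWithinAt_radialFactor_Ici s)

theorem continuous_radialFactor : Continuous radialFactor :=
  continuous_iff_continuousAt.2 fun s => (hasDerivAt_radialFactor s).continuousAt

theorem measurable_radialFactorDeriv : Measurable radialFactorDeriv :=
  Measurable.ite measurableSet_Iic (by fun_prop) (by fun_prop)

theorem radialFactor_nonneg (s : ℝ) : 0 ≤ radialFactor s := by
  rcases le_total s 1 with h | h
  · rw [radialFactor_of_le_one h]; linarith
  · rw [radialFactor_of_one_le h]; positivity

theorem radialFactor_le (hs : 0 ≤ s) : radialFactor s ≤ 1 / (1 + s) := by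
  rcases le_total s 1 with h | h
  · rw [radialFactor_of_le_one h, le_div_iff₀ (by linarith)]; nlinarith
  · rw [radialFactor_of_one_le h]
    exact one_div_le_one_div_of_le (by linarith) (by linarith)

theorem mul_abs_radialFactorDeriv_le (hs : 0 ≤ s) :
    2 * s * |radialFactorDeriv s| ≤ 1 / (1 + s) := by
  rcases le_total s 1 with h | h
  · rw [radialFactorDeriv_of_le_one h, abs_neg, abs_of_pos (by norm_num), le_div_iff₀ (by linarith)]
    nlinarith
  · rw [radialFactorDeriv_of_one_le h, abs_neg, abs_of_pos (by positivity)]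
    calc 2 * s * (1 / (4 * s ^ 2)) = 1 / (2 * s) := by field_simp; norm_num
      _ ≤ 1 / (1 + s) := one_div_le_one_div_of_le (by linarith) (by linarith)

/-- The bump `max (1 - ‖z‖²) 0`, supported in the closed unit disc. -/
def bump (z : Plane) : ℝ := max (1 - ‖z‖ ^ 2) 0

/-- The gradient of the radial potential of the bump: a curl-free field with divergence `bump`. -/
def bumpField (i : Fin 2) (z : Plane) : ℝ := z i * radialFactor (‖z‖ ^ 2)

/-- The partial derivative `∂ⱼ` of the `i`-th component of `bumpField`. -/
def bumpFieldDeriv (i j : Fin 2) (z : Plane) : ℝ :=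
  (if i = j then 1 else 0) * radialFactor (‖z‖ ^ 2) + 2 * z i * z j * radialFactorDeriv (‖z‖ ^ 2)

/-- The image of the bump under `R₁²`. -/
def bumpResponse (z : Plane) : ℝ := -bumpFieldDeriv 0 0 z

theorem norm_sq_eq (z : Plane) : ‖z‖ ^ 2 = z 0 ^ 2 + z 1 ^ 2 := by
  rw [EuclideanSpace.real_norm_sq_eq, Fin.sum_univ_two]

theorem abs_apply_le_norm (z : Plane) (i : Fin 2) : |z i| ≤ ‖z‖ := by
  simpa using PiLp.norm_apply_le z i

theorem hasDerivAt_norm_add_smul_unitVec_sq (z : Plane) (j : Fin 2) :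
    HasDerivAt (fun t : ℝ => ‖z + t • unitVec j‖ ^ 2) (2 * z j) 0 := by
  have h : HasDerivAt (fun t : ℝ => z + t • unitVec j) (unitVec j) 0 := by
    simpa using ((hasDerivAt_id (0 : ℝ)).smul_const (unitVec j)).const_add z
  simpa [EuclideanSpace.inner_single_right] using h.norm_sq

theorem hasLineDerivAt_bumpField (i j : Fin 2) (z : Plane) :
    HasLineDerivAt ℝ (bumpField i) (bumpFieldDeriv i j z) z (unitVec j) := by
  have hcoord : HasDerivAt (fun t : ℝ => (z + t • unitVec j) i) (if i = j then 1 else 0) 0 := by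
    simpa [Pi.single_apply] using
      ((hasDerivAt_id (0 : ℝ)).mul_const (if i = j then (1 : ℝ) else 0)).const_add (z i)
  have hradial := (hasDerivAt_radialFactor (‖z‖ ^ 2)).comp_of_eq 0
    (hasDerivAt_norm_add_smul_unitVec_sq z j) (by simp)
  refine (hcoord.mul hradial).congr_deriv ?_
  simp only [Function.comp_apply, zero_smul, add_zero, bumpFieldDeriv]
  ring

theorem bumpFieldDeriv_comm (i j : Fin 2) : bumpFieldDeriv i j = bumpFieldDeriv j i := by
  ext z
  simp only [bumpFieldDeriv, eq_comm (a := i)]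
  ring

theorem bump_eq_bumpFieldDeriv_add (z : Plane) :
    bump z = bumpFieldDeriv 0 0 z + bumpFieldDeriv 1 1 z := by
  have hz := norm_sq_eq z
  simp only [bump, bumpFieldDeriv, if_true]
  generalize ‖z‖ ^ 2 = s at *
  rcases le_total s 1 with h | h
  · rw [radialFactor_of_le_one h, radialFactorDeriv_of_le_one h, max_eq_left (by linarith)]
    linarith
  · rw [radialFactor_of_one_le h, radialFactorDeriv_of_one_le h, max_eq_right (by linarith)]
    field_simp
    linear_combination -2 * hz

theorem measurable_bumpField (i : Fin 2) : Measurable (bumpField i) := by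
  have : Continuous (bumpField i) :=
    (by fun_prop : Continuous fun z : Plane => z i).mul
      (continuous_radialFactor.comp (by fun_prop))
  exact this.measurable

theorem measurable_bumpFieldDeriv (i j : Fin 2) : Measurable (bumpFieldDeriv i j) := by
  have hcoord (k : Fin 2) : Measurable fun z : Plane => z k := by fun_prop
  have hnorm : Measurable fun z : Plane => ‖z‖ ^ 2 := by fun_prop
  exact ((continuous_radialFactor.measurable.comp hnorm).const_mul _).add
    ((((hcoord i).const_mul 2).mul (hcoord j)).mul (measurable_radialFactorDeriv.comp hnorm))

theorem abs_bumpField_le_one (i : Fin 2) (z : Plane) : |bumpField i z| ≤ 1 := by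
  rw [bumpField, abs_mul, abs_of_nonneg (radialFactor_nonneg _)]
  calc |z i| * radialFactor (‖z‖ ^ 2) ≤ ‖z‖ * (1 / (1 + ‖z‖ ^ 2)) :=
        mul_le_mul (abs_apply_le_norm z i) (radialFactor_le (sq_nonneg _)) (radialFactor_nonneg _)
          (norm_nonneg _)
    _ ≤ 1 := by
      rw [mul_one_div]
      exact div_le_one_of_le₀ (by nlinarith [sq_nonneg (‖z‖ - 1)]) (by positivity)

theorem abs_bumpFieldDeriv_le (i j : Fin 2) (z : Plane) :
    |bumpFieldDeriv i j z| ≤ 2 / (1 + ‖z‖ ^ 2) := by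
  have hs : 0 ≤ ‖z‖ ^ 2 := sq_nonneg _
  have hdiag : |(if i = j then 1 else 0) * radialFactor (‖z‖ ^ 2)| ≤ 1 / (1 + ‖z‖ ^ 2) := by
    split_ifs
    · rw [one_mul, abs_of_nonneg (radialFactor_nonneg _)]
      exact radialFactor_le hs
    · rw [zero_mul, abs_zero]
      positivity
  have hradial : |2 * z i * z j * radialFactorDeriv (‖z‖ ^ 2)| ≤ 1 / (1 + ‖z‖ ^ 2) := by
    refine le_trans ?_ (mul_abs_radialFactorDeriv_le hs)
    rw [abs_mul, mul_assoc 2, abs_mul, abs_mul, abs_two, sq]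
    gcongr <;> exact abs_apply_le_norm z _
  calc |bumpFieldDeriv i j z| ≤ 1 / (1 + ‖z‖ ^ 2) + 1 / (1 + ‖z‖ ^ 2) :=
        (abs_add_le _ _).trans (add_le_add hdiag hradial)
    _ = 2 / (1 + ‖z‖ ^ 2) := by ring

theorem bump_nonneg (z : Plane) : 0 ≤ bump z := le_max_right _ _

theorem bump_eq_zero {z : Plane} (h : 1 ≤ ‖z‖) : bump z = 0 :=
  max_eq_right (by nlinarith)

theorem memLp_bump (p : ℝ≥0∞) : MemLp bump p volume := by
  have hcont : Continuous bump := by unfold bump; fun_prop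
  refine hcont.memLp_of_hasCompactSupport
    (.intro (isCompact_closedBall (0 : Plane) 1) fun z hz => bump_eq_zero ?_)
  exact (not_le.1 (mt mem_closedBall_zero_iff.2 hz)).le

theorem memLp_top_bumpField (i : Fin 2) : MemLp (bumpField i) ∞ volume :=
  memLp_top_of_bound (measurable_bumpField i).aestronglyMeasurable 1
    (.of_forall fun z => abs_bumpField_le_one i z)

theorem memLp_bumpFieldDeriv {p : ℝ≥0∞} (hp : 1 < p) (i j : Fin 2) :
    MemLp (bumpFieldDeriv i j) p volume := by
  have hmeas := (measurable_bumpFieldDeriv i j).aestronglyMeasurable (μ := volume)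
  rcases eq_or_ne p ∞ with rfl | hp_top
  · refine memLp_top_of_bound hmeas 2 (.of_forall fun z => (abs_bumpFieldDeriv_le i j z).trans ?_)
    exact div_le_self zero_le_two (by nlinarith [sq_nonneg ‖z‖])
  have hp' : 1 < p.toReal := by
    simpa using (ENNReal.toReal_lt_toReal ENNReal.one_ne_top hp_top).2 hp
  have hdecay : MemLp (fun z : Plane => (1 + ‖z‖) ^ (-2 : ℝ)) p volume := by
    rw [← integrable_norm_rpow_iff (Measurable.aestronglyMeasurable (by measurability))
      (by positivity) hp_top]
    refine (integrable_one_add_norm (r := 2 * p.toReal) (by simp; linarith)).congr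
      (.of_forall fun z => ?_)
    simp only [Real.norm_of_nonneg (by positivity : 0 ≤ (1 + ‖z‖) ^ (-2 : ℝ))]
    rw [← Real.rpow_mul (by positivity), neg_mul]
  refine (hdecay.const_mul 4).of_le hmeas
    (.of_forall fun z => (abs_bumpFieldDeriv_le i j z).trans ?_)
  rw [Real.norm_of_nonneg (by positivity), Real.rpow_neg (by positivity), Real.rpow_two,
    ← div_eq_mul_inv, div_le_div_iff₀ (by positivity) (by positivity)]
  nlinarith [sq_nonneg (‖z‖ - 1)]

theorem memLp_bumpResponse {p : ℝ≥0∞} (hp : 1 < p) : MemLp bumpResponse p volume :=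
  (memLp_bumpFieldDeriv hp 0 0).neg

theorem neg_half_le_bumpResponse {z : Plane} (h : ‖z‖ ≤ 1) : -(1 / 2) ≤ bumpResponse z := by
  have h1 : ‖z‖ ^ 2 ≤ 1 := pow_le_one₀ (norm_nonneg _) h
  rw [bumpResponse, bumpFieldDeriv, if_pos rfl, radialFactor_of_le_one h1,
    radialFactorDeriv_of_le_one h1]
  nlinarith [sq_nonneg (z 0), sq_nonneg ‖z‖]

theorem bumpResponse_of_one_le {z : Plane} (h : 1 ≤ ‖z‖) :
    bumpResponse z = (z 0 ^ 2 - z 1 ^ 2) / (4 * (‖z‖ ^ 2) ^ 2) := by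
  have h1 : 1 ≤ ‖z‖ ^ 2 := one_le_pow₀ h
  have hz := norm_sq_eq z
  rw [bumpResponse, bumpFieldDeriv, if_pos rfl, radialFactor_of_one_le h1,
    radialFactorDeriv_of_one_le h1]
  field_simp
  linear_combination -hz

end Bump

section RescaledBump

theorem hasLineDerivAt_rescale {E : Type*} [AddCommGroup E] [Module ℝ E] {F : E → ℝ} {F' : ℝ}
    {x y a : E} {r : ℝ} (hr : r ≠ 0) (h : HasLineDerivAt ℝ F F' (r⁻¹ • (x - y)) a) :
    HasLineDerivAt ℝ (fun x => r * F (r⁻¹ • (x - y))) F' x a := by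
  have hscale : HasDerivAt (fun t : ℝ => r⁻¹ * t) r⁻¹ 0 := by
    simpa using (hasDerivAt_id (0 : ℝ)).const_mul r⁻¹
  refine (((HasDerivAt.comp_of_eq 0 h hscale (by simp)).const_mul r).congr_deriv
    (by field_simp)).congr_of_eventuallyEq (.of_forall fun t => ?_)
  have harg : r⁻¹ • (x + t • a - y) = r⁻¹ • (x - y) + (r⁻¹ * t) • a := by module
  simp only [harg, Function.comp_apply]

theorem isWeakRieszOneSq_bump_rescale (y : Plane) {r : ℝ} (hr : 0 < r) :
    IsWeakRieszOneSq (fun x => (bump (r⁻¹ • (x - y)) : ℂ))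
      (fun x => (bumpResponse (r⁻¹ • (x - y)) : ℂ)) := by
  choose V hV using fun i => exists_represents_of_memLp
    (((memLp_rescale (memLp_top_bumpField i) hr y).const_mul r).ofReal (K := ℂ))
  have hderiv (i j : Fin 2) : Represents (fun x => (bumpFieldDeriv i j (r⁻¹ • (x - y)) : ℂ))
      (∂_{unitVec j} (V i)) := by
    refine (hV i).lineDerivOp (fun x => ?_) fun φ => ?_
    · exact (hasLineDerivAt_rescale hr.ne'
        (hasLineDerivAt_bumpField i j (r⁻¹ • (x - y)))).ofReal_comp
    · exact φ.integrable.mul_of_top_left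
        (memLp_rescale (memLp_bumpFieldDeriv ENNReal.one_lt_top i j) hr y).ofReal
  have hcurl : ∂_{unitVec 0} (V 1) = ∂_{unitVec 1} (V 0) :=
    (hderiv 1 0).unique (bumpFieldDeriv_comm 0 1 ▸ hderiv 0 1)
  refine isWeakRieszOneSq_of_laplacian_eq (T := ∂_{unitVec 0} (V 0) + ∂_{unitVec 1} (V 1))
    (S := -∂_{unitVec 0} (V 0))
    (memLp_one_iff_integrable.1 (memLp_rescale (memLp_bump 1) hr y)).ofReal
    (memLp_rescale (memLp_bumpResponse (by norm_num)) hr y).ofReal ?_ ?_ ?_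
  · simpa only [bump_eq_bumpFieldDeriv_add, Complex.ofReal_add] using (hderiv 0 0).add (hderiv 1 1)
  · simpa only [bumpResponse, Complex.ofReal_neg] using (hderiv 0 0).neg
  · rw [← TemperedDistribution.laplacianCLM_apply, map_neg,
      TemperedDistribution.laplacianCLM_apply, laplacian_lineDerivOp_of_curl_eq_zero hcurl]

end RescaledBump

section BumpSuperposition

variable {ι : Type*} [Countable ι] {c r : ι → ℝ} {y : ι → Plane}

theorem isRieszOneSq_superposition {p : ℝ≥0∞} (hp : 1 < p) (hp_top : p ≠ ∞) (hc : ∀ i, 0 ≤ c i)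
    (hr : ∀ i, 0 < r i) (hs₁ : Summable fun i => c i * r i ^ 2)
    (hs : Summable fun i => c i * r i ^ (2 / p.toReal)) :
    IsRieszOneSq (fun x => (superposition c r y bump x : ℂ))
      (fun x => (superposition c r y bumpResponse x : ℂ)) := by
  have hs₁' : Summable fun i => c i * r i ^ (finrank ℝ Plane / (1 : ℝ≥0∞).toReal) := by
    simpa using hs₁
  have hs' : Summable fun i => c i * r i ^ (finrank ℝ Plane / p.toReal) := by simpa using hs
  have hcast (f : Plane → ℝ) (q : ℝ≥0∞) :
      eLpNorm (fun x => (f x : ℂ)) q volume = eLpNorm f q volume :=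
    eLpNorm_congr_norm_ae (.of_forall fun x => Complex.norm_real (f x))
  have hweak : IsWeakRieszOneSq (fun x => (superposition c r y bump x : ℂ))
      (fun x => (superposition c r y bumpResponse x : ℂ)) := by
    simp only [superposition, Complex.ofReal_tsum]
    refine .tsum (p := p) (fun i => ?_) hp.le
      (fun i => ((memLp_rescale (memLp_bump 1) (hr i) (y i)).const_mul (c i)).ofReal) ?_
      (fun i => ((memLp_rescale (memLp_bumpResponse hp) (hr i) (y i)).const_mul (c i)).ofReal) ?_
    · simpa only [Complex.ofReal_mul] using (isWeakRieszOneSq_bump_rescale (y i) (hr i)).const_mul _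
    · simpa only [hcast] using
        tsum_eLpNorm_rescale_ne_top (y := y) ENNReal.one_ne_top (memLp_bump 1) hc hr hs₁'
    · simpa only [hcast] using
        tsum_eLpNorm_rescale_ne_top (y := y) hp_top (memLp_bumpResponse hp) hc hr hs'
  exact hweak.isRieszOneSq (memLp_one_iff_integrable.1
    (memLp_superposition le_rfl ENNReal.one_ne_top (memLp_bump 1) hc hr hs₁')).ofReal

theorem eLpNorm_bump_ne_zero {p : ℝ≥0∞} (hp : p ≠ 0) : eLpNorm bump p volume ≠ 0 := by
  have hcont : Continuous bump := by unfold bump; fun_prop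
  rw [Ne, eLpNorm_eq_zero_iff hcont.aestronglyMeasurable hp,
    hcont.ae_eq_iff_eq volume continuous_zero]
  exact fun h => by simpa [bump] using congrFun h 0

end BumpSuperposition

section Discs

/-- The radii of the discs. Disc `(n, k)` is the `k`-th disc of the cluster at height `2⁻ⁿ`. -/
def discRadius (i : ℕ × ℕ) : ℝ := (1 / 2) ^ i.1 * (1 / 2) ^ i.2 / 800

/-- The centres of the discs. Those of cluster `n` tend horizontally to the tip `(0, 2⁻ⁿ)`. -/
def discCenter (i : ℕ × ℕ) : Plane := !₂[8 * discRadius i, (1 / 2) ^ i.1]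

/-- The heights of the bumps. The masses of the bumps of one cluster are in a geometric
progression, whose ratio is chosen close to `1` so that the discs to the left of a given disc of
the cluster carry much more mass than the disc itself. -/
def discCoeff (i : ℕ × ℕ) : ℝ := 2 ^ i.1 * (999 / 250) ^ i.2

/-- The closed discs that carry the bumps. -/
def disc (i : ℕ × ℕ) : Set Plane := Metric.closedBall (discCenter i) (discRadius i)

variable {i : ℕ × ℕ} {x : Plane}

theorem discRadius_pos (i : ℕ × ℕ) : 0 < discRadius i := by unfold discRadius; positivity

theorem discCoeff_nonneg (i : ℕ × ℕ) : 0 ≤ discCoeff i := by unfold discCoeff; positivity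

theorem discRadius_le (i : ℕ × ℕ) : discRadius i ≤ (1 / 2) ^ i.1 / 800 := by
  unfold discRadius
  gcongr
  exact mul_le_of_le_one_right (by positivity) (pow_le_one₀ (by norm_num) (by norm_num))

theorem half_pow_le_half {m n : ℕ} (h : m < n) : (1 / 2 : ℝ) ^ n ≤ (1 / 2) ^ m / 2 :=
  (pow_le_pow_of_le_one (by norm_num) (by norm_num) h).trans_eq (by rw [pow_succ]; ring)

theorem discRadius_le_half (n : ℕ) {k l : ℕ} (h : k < l) :
    discRadius (n, l) ≤ discRadius (n, k) / 2 := by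
  have := mul_le_mul_of_nonneg_left (half_pow_le_half h) (by positivity : (0 : ℝ) ≤ (1 / 2) ^ n)
  simp only [discRadius]
  linarith

theorem sub_discCenter_apply_zero (x : Plane) (i : ℕ × ℕ) :
    (x - discCenter i) 0 = x 0 - 8 * discRadius i := rfl

theorem sub_discCenter_apply_one (x : Plane) (i : ℕ × ℕ) :
    (x - discCenter i) 1 = x 1 - (1 / 2) ^ i.1 := rfl

theorem mem_disc : x ∈ disc i ↔ ‖x - discCenter i‖ ≤ discRadius i := mem_closedBall_iff_norm

theorem apply_zero_mem_Icc_of_mem_disc (hx : x ∈ disc i) :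
    x 0 ∈ Set.Icc (7 * discRadius i) (9 * discRadius i) := by
  have h := abs_le.1 ((abs_apply_le_norm (x - discCenter i) 0).trans (mem_disc.1 hx))
  rw [sub_discCenter_apply_zero] at h
  constructor <;> linarith [h.1, h.2]

theorem abs_apply_one_sub_le_of_mem_disc (hx : x ∈ disc i) :
    |x 1 - (1 / 2) ^ i.1| ≤ discRadius i :=
  (abs_apply_le_norm (x - discCenter i) 1).trans (mem_disc.1 hx)

theorem apply_one_mem_Icc_of_mem_disc (hx : x ∈ disc i) :
    x 1 ∈ Set.Icc (99 / 100 * (1 / 2) ^ i.1) (101 / 100 * (1 / 2) ^ i.1) := by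
  have h := abs_le.1 (abs_apply_one_sub_le_of_mem_disc hx)
  have hr := discRadius_le i
  have hpos : (0 : ℝ) < (1 / 2) ^ i.1 := by positivity
  constructor <;> linarith [h.1, h.2]

theorem abs_apply_zero_le_of_mem_disc (hx : x ∈ disc i) : |x 0| ≤ x 1 / 10 := by
  have h₀ := apply_zero_mem_Icc_of_mem_disc hx
  have h₁ := apply_one_mem_Icc_of_mem_disc hx
  have hr := discRadius_le i
  have hpos := discRadius_pos i
  exact abs_le.2 ⟨by linarith [h₀.1, h₁.1], by linarith [h₀.2, h₁.1]⟩

theorem norm_le_of_mem_disc (hx : x ∈ disc i) : ‖x‖ ≤ 2 * (1 / 2) ^ i.1 := by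
  have h₀ := abs_apply_zero_le_of_mem_disc hx
  have h₁ := (apply_one_mem_Icc_of_mem_disc hx).2
  have hpos : (0 : ℝ) < (1 / 2) ^ i.1 := by positivity
  refine abs_le_of_sq_le_sq' ?_ (by positivity) |>.2
  rw [norm_sq_eq, ← sq_abs (x 0)]
  nlinarith [abs_nonneg (x 0)]

theorem bump_rescale_eq_zero_of_notMem_disc (hx : x ∉ disc i) :
    bump ((discRadius i)⁻¹ • (x - discCenter i)) = 0 := by
  refine bump_eq_zero ?_
  rw [norm_smul, norm_inv, Real.norm_of_nonneg (discRadius_pos i).le, ← div_eq_inv_mul,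
    one_le_div (discRadius_pos i)]
  exact (not_le.1 (mt mem_disc.2 hx)).le

theorem exists_mem_disc_of_superposition_ne_zero
    (hx : superposition discCoeff discRadius discCenter bump x ≠ 0) : ∃ i, x ∈ disc i := by
  by_contra! h
  simp [superposition, bump_rescale_eq_zero_of_notMem_disc (h _)] at hx

theorem superposition_bump_nonneg (x : Plane) :
    0 ≤ superposition discCoeff discRadius discCenter bump x :=
  tsum_nonneg fun i => mul_nonneg (discCoeff_nonneg i) (bump_nonneg _)

theorem discCoeff_mul_discRadius_rpow (i : ℕ × ℕ) (s : ℝ) :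
    discCoeff i * discRadius i ^ s =
      (1 / 800) ^ s * ((2 * (1 / 2) ^ s) ^ i.1 * (999 / 250 * (1 / 2) ^ s) ^ i.2) := by
  rw [discRadius, div_eq_mul_one_div, Real.mul_rpow (by positivity) (by positivity),
    Real.mul_rpow (by positivity) (by positivity), ← Real.rpow_pow_comm (by norm_num),
    ← Real.rpow_pow_comm (by norm_num), discCoeff, mul_pow, mul_pow]
  ring

theorem discCoeff_mul_discRadius_sq (i : ℕ × ℕ) :
    discCoeff i * discRadius i ^ 2 = (1 / 2) ^ i.1 * (999 / 1000) ^ i.2 / 640000 := by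
  rw [← Real.rpow_two, discCoeff_mul_discRadius_rpow]
  norm_num
  ring

theorem summable_pow_mul_pow {a b : ℝ} (ha : 0 ≤ a) (ha' : a < 1) (hb : 0 ≤ b) (hb' : b < 1) :
    Summable fun i : ℕ × ℕ => a ^ i.1 * b ^ i.2 :=
  (summable_geometric_of_lt_one ha ha').mul_of_nonneg (summable_geometric_of_lt_one hb hb')
    (fun _ => pow_nonneg ha _) fun _ => pow_nonneg hb _

theorem summable_discCoeff_mul_discRadius_rpow {s : ℝ} (hs : 999 / 250 * (1 / 2 : ℝ) ^ s < 1) :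
    Summable fun i => discCoeff i * discRadius i ^ s := by
  have hpos : (0 : ℝ) < (1 / 2) ^ s := by positivity
  simp_rw [discCoeff_mul_discRadius_rpow]
  exact (summable_pow_mul_pow (by positivity) (by linarith) (by positivity) hs).mul_left _

theorem summable_discCoeff_mul_discRadius_sq :
    Summable fun i => discCoeff i * discRadius i ^ 2 := by
  simp only [← Real.rpow_two]
  exact summable_discCoeff_mul_discRadius_rpow (by norm_num)

theorem exists_summable_discCoeff_mul_discRadius_rpow :
    ∃ p : ℝ≥0∞, 1 < p ∧ p < 2 ∧ Summable fun i => discCoeff i * discRadius i ^ (2 / p.toReal) := by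
  have hcont : ContinuousAt (fun p : ℝ => 999 / 250 * (1 / 2 : ℝ) ^ (2 / p)) 1 :=
    continuousAt_const.mul (ContinuousAt.rpow continuousAt_const
      (continuousAt_const.div continuousAt_id one_ne_zero) (.inl (by norm_num)))
  have hnear : ∀ᶠ p in 𝓝[>] (1 : ℝ), p < 2 ∧ 999 / 250 * (1 / 2 : ℝ) ^ (2 / p) < 1 :=
    nhdsWithin_le_nhds ((eventually_lt_nhds one_lt_two).and
      (hcont.eventually_lt continuousAt_const (by norm_num)))
  obtain ⟨p, ⟨hp_two, hs⟩, hp_one : 1 < p⟩ := (hnear.and self_mem_nhdsWithin).exists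
  refine ⟨ENNReal.ofReal p, ?_, ?_, ?_⟩
  · simpa using hp_one
  · simpa using hp_two
  · rw [ENNReal.toReal_ofReal (by linarith)]
    exact summable_discCoeff_mul_discRadius_rpow hs

theorem tendsto_discCoeff_mul_discRadius_atTop (n : ℕ) :
    Tendsto (fun k => discCoeff (n, k) * discRadius (n, k)) atTop atTop := by
  have heq (k : ℕ) : discCoeff (n, k) * discRadius (n, k) = 1 / 800 * (999 / 500) ^ k := by
    have h := discCoeff_mul_discRadius_rpow (n, k) 1
    norm_num at h
    linarith
  simp_rw [heq]
  exact (tendsto_pow_atTop_atTop_of_one_lt (by norm_num)).const_mul_atTop (by norm_num)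

theorem tendsto_discRadius_cofinite : Tendsto discRadius cofinite (𝓝 0) :=
  ((summable_pow_mul_pow (by norm_num) (by norm_num) (by norm_num) (by norm_num)).div_const
    800).tendsto_cofinite_zero

end Discs

section Response

variable {r : ℝ} {x y : Plane}

theorem bumpResponse_rescale (hr : 0 < r) (h : r ≤ ‖x - y‖) :
    bumpResponse (r⁻¹ • (x - y)) =
      r ^ 2 * (((x - y) 0 ^ 2 - (x - y) 1 ^ 2) / (4 * (‖x - y‖ ^ 2) ^ 2)) := by
  have hnorm : ‖r⁻¹ • (x - y)‖ = ‖x - y‖ / r := by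
    rw [norm_smul, norm_inv, Real.norm_of_nonneg hr.le, div_eq_inv_mul]
  have hpos : 0 < ‖x - y‖ := hr.trans_le h
  rw [bumpResponse_of_one_le (by rwa [hnorm, one_le_div hr]), hnorm]
  simp only [PiLp.smul_apply, smul_eq_mul]
  field_simp

theorem neg_le_bumpResponse_rescale {d : ℝ} (hr : 0 < r) (hrd : r ≤ d) (h : d ≤ ‖x - y‖) :
    -(r ^ 2 / (4 * d ^ 2)) ≤ bumpResponse (r⁻¹ • (x - y)) := by
  have hd : 0 < d := hr.trans_le hrd
  have hpos : 0 < ‖x - y‖ := hd.trans_le h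
  calc -(r ^ 2 / (4 * d ^ 2)) ≤ -(r ^ 2 / (4 * ‖x - y‖ ^ 2)) := by gcongr
    _ = r ^ 2 * (-‖x - y‖ ^ 2 / (4 * (‖x - y‖ ^ 2) ^ 2)) := by field_simp
    _ ≤ bumpResponse (r⁻¹ • (x - y)) := by
      rw [bumpResponse_rescale hr (hrd.trans h)]
      gcongr
      rw [norm_sq_eq]
      linarith [sq_nonneg ((x - y) 0)]

theorem bumpResponse_rescale_nonneg (hr : 0 < r) (h : r ≤ ‖x - y‖)
    (hxy : |(x - y) 1| ≤ |(x - y) 0|) : 0 ≤ bumpResponse (r⁻¹ • (x - y)) := by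
  rw [bumpResponse_rescale hr h]
  have := sub_nonneg.2 (sq_le_sq.2 hxy)
  positivity

theorem le_bumpResponse_rescale {ρ : ℝ} (hr : 0 < r) (hrρ : r ≤ ρ)
    (h₀ : (x - y) 0 ∈ Set.Icc (3 * ρ) (9 * ρ)) (h₁ : |(x - y) 1| ≤ ρ) :
    r ^ 2 / (512 * ρ ^ 2) ≤ bumpResponse (r⁻¹ • (x - y)) := by
  have hρ : 0 < ρ := hr.trans_le hrρ
  have hr' : r ≤ ‖x - y‖ := by
    linarith [h₀.1, le_abs_self ((x - y) 0), abs_apply_le_norm (x - y) 0]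
  rw [bumpResponse_rescale hr hr', norm_sq_eq, div_eq_mul_one_div]
  gcongr r ^ 2 * ?_
  obtain ⟨h3, h9⟩ := h₀
  have hY : 9 * (x - y) 1 ^ 2 ≤ (x - y) 0 ^ 2 := by
    rw [← sq_abs ((x - y) 1)]
    nlinarith [abs_nonneg ((x - y) 1)]
  have hX : (x - y) 0 ^ 2 ≤ 81 * ρ ^ 2 := by nlinarith
  generalize (x - y) 0 = X at *
  generalize (x - y) 1 = Y at *
  have hX0 : 0 < X ^ 2 := pow_pos (by linarith) 2
  calc 1 / (512 * ρ ^ 2) ≤ 81 / 512 / X ^ 2 := by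
        rw [div_le_div_iff₀ (by positivity) hX0]
        linarith
    _ ≤ 8 / 9 * X ^ 2 / (4 * (10 / 9 * X ^ 2) ^ 2) := by
        rw [div_le_div_iff₀ hX0 (by positivity)]
        nlinarith [pow_pos hX0 2]
    _ ≤ (X ^ 2 - Y ^ 2) / (4 * (X ^ 2 + Y ^ 2) ^ 2) := by
        gcongr <;> linarith

end Response

section Positivity

/-- The image under `R₁²` of the bump carried by disc `i`, with its height. -/
def discResponse (i : ℕ × ℕ) (x : Plane) : ℝ :=
  discCoeff i * bumpResponse ((discRadius i)⁻¹ • (x - discCenter i))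

variable {n m k l : ℕ} {x : Plane}

theorem le_norm_sub_discCenter_of_cluster_ne (hx : x ∈ disc (n, k)) (hm : m ≠ n) (l : ℕ) :
    (1 / 2) ^ min m n / 4 ≤ ‖x - discCenter (m, l)‖ := by
  have h := apply_one_mem_Icc_of_mem_disc hx
  have hnorm := abs_apply_le_norm (x - discCenter (m, l)) 1
  rw [sub_discCenter_apply_one] at hnorm
  refine le_trans ?_ hnorm
  have hm_pos : (0 : ℝ) < (1 / 2) ^ m := by positivity
  have hn_pos : (0 : ℝ) < (1 / 2) ^ n := by positivity
  simp only at h ⊢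
  rcases hm.lt_or_gt with hlt | hlt
  · rw [min_eq_left hlt.le]
    linarith [h.2, half_pow_le_half hlt, neg_abs_le (x 1 - (1 / 2) ^ m)]
  · rw [min_eq_right hlt.le]
    linarith [h.1, half_pow_le_half hlt, le_abs_self (x 1 - (1 / 2) ^ m)]

theorem half_pow_div_half_pow_min_sq (m n : ℕ) :
    (1 / 2 : ℝ) ^ m / ((1 / 2) ^ min m n) ^ 2 = 2 ^ n * (1 / 2) ^ Nat.dist m n := by
  rcases le_total m n with h | h
  · rw [min_eq_left h, Nat.dist_eq_sub_of_le h]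
    obtain ⟨d, rfl⟩ := Nat.exists_eq_add_of_le h
    simp only [one_div, inv_pow, add_tsub_cancel_left, pow_add]
    field_simp
  · rw [min_eq_right h, Nat.dist_eq_sub_of_le_right h]
    obtain ⟨d, rfl⟩ := Nat.exists_eq_add_of_le h
    simp only [one_div, inv_pow, add_tsub_cancel_left, pow_add]
    field_simp

theorem neg_le_discResponse_of_cluster_ne (hx : x ∈ disc (n, k)) (hm : m ≠ n) (l : ℕ) :
    -(2 ^ n * (1 / 2) ^ Nat.dist m n / 160000 * (999 / 1000) ^ l) ≤ discResponse (m, l) x := by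
  have hr : discRadius (m, l) ≤ (1 / 2) ^ min m n / 4 := by
    have hmin : (1 / 2 : ℝ) ^ m ≤ (1 / 2) ^ min m n :=
      pow_le_pow_of_le_one (by norm_num) (by norm_num) (min_le_left m n)
    have hpos : (0 : ℝ) < (1 / 2) ^ m := by positivity
    linarith [discRadius_le (m, l)]
  have h := mul_le_mul_of_nonneg_left (neg_le_bumpResponse_rescale (discRadius_pos (m, l)) hr
    (le_norm_sub_discCenter_of_cluster_ne hx hm l)) (discCoeff_nonneg (m, l))
  refine le_of_eq_of_le ?_ h
  have hmass := discCoeff_mul_discRadius_sq (m, l)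
  calc -(2 ^ n * (1 / 2) ^ Nat.dist m n / 160000 * (999 / 1000) ^ l)
      = -((1 / 2) ^ m * (999 / 1000) ^ l / 640000 * (4 / ((1 / 2) ^ min m n) ^ 2)) := by
        rw [← half_pow_div_half_pow_min_sq]
        ring
    _ = discCoeff (m, l) *
        -(discRadius (m, l) ^ 2 / (4 * ((1 / 2) ^ min m n / 4) ^ 2)) := by
        rw [← hmass]
        field_simp

theorem tsum_mass_ratio_pow : ∑' l : ℕ, (999 / 1000 : ℝ) ^ l = 1000 := by
  rw [tsum_geometric_of_lt_one (by norm_num) (by norm_num)]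
  norm_num

theorem summable_mass_ratio_pow : Summable fun l : ℕ => (999 / 1000 : ℝ) ^ l :=
  summable_geometric_of_lt_one (by norm_num) (by norm_num)

theorem neg_le_tsum_discResponse_of_cluster_ne (hs : Summable fun i => discResponse i x)
    (hx : x ∈ disc (n, k)) (hm : m ≠ n) :
    -(2 ^ n / 160 * (1 / 2) ^ Nat.dist m n) ≤ ∑' l, discResponse (m, l) x := by
  have h := (summable_mass_ratio_pow.mul_left _).neg.tsum_le_tsum
    (neg_le_discResponse_of_cluster_ne hx hm) (hs.prod_factor m)
  rw [tsum_neg, tsum_mul_left, tsum_mass_ratio_pow] at h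
  linarith

theorem discResponse_nonneg_of_larger_disc (hx : x ∈ disc (n, k)) (hl : l < k) :
    0 ≤ discResponse (n, l) x := by
  have h := (apply_zero_mem_Icc_of_mem_disc hx).2
  have hr := discRadius_le_half n hl
  have hpos := discRadius_pos (n, k)
  have h₀ : discRadius (n, l) ≤ |(x - discCenter (n, l)) 0| := by
    rw [sub_discCenter_apply_zero]
    linarith [neg_abs_le (x 0 - 8 * discRadius (n, l))]
  refine mul_nonneg (discCoeff_nonneg _) (bumpResponse_rescale_nonneg (discRadius_pos _)
    (h₀.trans (abs_apply_le_norm _ 0)) (le_trans ?_ h₀))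
  exact (abs_apply_one_sub_le_of_mem_disc hx).trans (by linarith)

theorem neg_half_discCoeff_le_discResponse (hx : x ∈ disc (n, k)) :
    -(discCoeff (n, k) / 2) ≤ discResponse (n, k) x := by
  have h : ‖(discRadius (n, k))⁻¹ • (x - discCenter (n, k))‖ ≤ 1 := by
    rw [norm_smul, norm_inv, Real.norm_of_nonneg (discRadius_pos _).le, ← div_eq_inv_mul,
      div_le_one (discRadius_pos _)]
    exact mem_disc.1 hx
  have := mul_le_mul_of_nonneg_left (neg_half_le_bumpResponse h) (discCoeff_nonneg (n, k))
  rw [discResponse]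
  linarith

theorem le_discResponse_of_smaller_disc (hx : x ∈ disc (n, k)) (j : ℕ) :
    discCoeff (n, k) / 512 * (999 / 1000) ^ (j + 1) ≤ discResponse (n, j + (k + 1)) x := by
  have hr := discRadius_le_half n (by omega : k < j + (k + 1))
  have hpos := discRadius_pos (n, j + (k + 1))
  have hρ := discRadius_pos (n, k)
  have h := apply_zero_mem_Icc_of_mem_disc hx
  have h₀ : (x - discCenter (n, j + (k + 1))) 0 ∈
      Set.Icc (3 * discRadius (n, k)) (9 * discRadius (n, k)) := by
    rw [sub_discCenter_apply_zero]
    constructor <;> linarith [h.1, h.2]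
  refine le_of_eq_of_le ?_ (mul_le_mul_of_nonneg_left (le_bumpResponse_rescale hpos (by linarith) h₀
    (abs_apply_one_sub_le_of_mem_disc hx)) (discCoeff_nonneg _))
  have hmass : discCoeff (n, j + (k + 1)) * discRadius (n, j + (k + 1)) ^ 2 =
      discCoeff (n, k) * discRadius (n, k) ^ 2 * (999 / 1000) ^ (j + 1) := by
    simp only [discCoeff_mul_discRadius_sq]
    ring
  rw [mul_div_assoc', hmass]
  field_simp

theorem two_pow_le_tsum_discResponse (hs : Summable fun i => discResponse i x)
    (hx : x ∈ disc (n, k)) : 2 ^ n ≤ ∑' l, discResponse (n, l) x := by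
  have hlarger : 0 ≤ ∑ l ∈ Finset.range k, discResponse (n, l) x :=
    Finset.sum_nonneg fun l hl => discResponse_nonneg_of_larger_disc hx (Finset.mem_range.1 hl)
  have hsmaller := (((summable_nat_add_iff 1).2 summable_mass_ratio_pow).mul_left _).tsum_le_tsum
    (le_discResponse_of_smaller_disc hx)
    ((hs.prod_factor n).comp_injective (add_left_injective (k + 1)))
  simp only [pow_succ', tsum_mul_left, tsum_mass_ratio_pow] at hsmaller
  have hown := neg_half_discCoeff_le_discResponse hx
  have hcoeff : 2 ^ n ≤ discCoeff (n, k) :=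
    le_mul_of_one_le_right (by positivity) (one_le_pow₀ (by norm_num))
  have hpos : (0 : ℝ) < 2 ^ n := by positivity
  rw [← (hs.prod_factor n).sum_add_tsum_nat_add (k + 1), Finset.sum_range_succ]
  linarith

theorem hasSum_half_pow_dist (n : ℕ) :
    HasSum (fun m => (1 / 2 : ℝ) ^ Nat.dist m n) (3 - (1 / 2) ^ n) := by
  induction n with
  | zero =>
    have hval : (3 - (1 / 2) ^ 0 : ℝ) = 2 := by norm_num
    simpa only [hval, Nat.dist_zero_right] using hasSum_geometric_two
  | succ n ih =>
    refine (hasSum_nat_add_iff' 1).1 ?_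
    have hval : 3 - (1 / 2 : ℝ) ^ (n + 1) - ∑ m ∈ Finset.range 1, (1 / 2) ^ Nat.dist m (n + 1) =
        3 - (1 / 2) ^ n := by
      simp [Nat.dist, pow_succ]
      ring
    simpa only [hval, Nat.dist_succ_succ] using ih

theorem tsum_discResponse_nonneg (hs : Summable fun i => discResponse i x)
    (hx : x ∈ disc (n, k)) : 0 ≤ ∑' i, discResponse i x := by
  have hs' : Summable fun m => ∑' l, discResponse (m, l) x := hs.prod
  have hother (m : ℕ) : -(2 ^ n / 160 * (1 / 2) ^ Nat.dist m n) ≤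
      if m = n then 0 else ∑' l, discResponse (m, l) x := by
    split_ifs with hm
    · simp only [Left.neg_nonpos_iff]
      positivity
    · exact neg_le_tsum_discResponse_of_cluster_ne hs hx hm
  have hsum := ((hasSum_half_pow_dist n).mul_left (2 ^ n / 160)).neg.summable.tsum_le_tsum hother
    (hs'.congr_cofinite ((Set.finite_singleton n).subset fun m hm => by
      by_contra h
      exact hm (if_neg h).symm))
  rw [((hasSum_half_pow_dist n).mul_left _).neg.tsum_eq] at hsum
  rw [hs.tsum_prod, hs'.tsum_eq_add_tsum_ite n]
  have hown := two_pow_le_tsum_discResponse hs hx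
  have hn : (0 : ℝ) < 2 ^ n := by positivity
  have hpos : (0 : ℝ) < 2 ^ n / 160 * (1 / 2) ^ n := by positivity
  linarith

end Positivity

section Location

variable {x : Plane}

theorem mem_verticalCone_of_abs_le (h₁ : 0 < x 1) (h₀ : |x 0| ≤ x 1 / 10) : x ∈ verticalCone := by
  have ht : |x 0 / x 1| ≤ 1 / 10 := by
    rw [abs_div, abs_of_pos h₁, div_le_iff₀ h₁]
    linarith
  obtain ⟨ht₀, ht₁⟩ := abs_le.1 ht
  have hpi := Real.pi_gt_three
  have hsmall : Real.arctan (1 / 10) < 1 / 10 := by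
    have h := Real.arctan_strictMono (Real.lt_tan (by norm_num : (0 : ℝ) < 1 / 10) (by linarith))
    rwa [Real.arctan_tan (by linarith) (by linarith)] at h
  have hupper := Real.arctan_mono ht₁
  have hlower := Real.arctan_mono ht₀
  rw [Real.arctan_neg] at hlower
  refine ⟨x 1 * √(1 + (x 0 / x 1) ^ 2), Real.pi / 2 - Real.arctan (x 0 / x 1), by positivity,
    ?_, ?_, ?_, ?_⟩
  · rw [abs_of_pos (by linarith)]
    linarith
  · rw [abs_of_pos (by linarith)]
    linarith
  · rw [Real.cos_pi_div_two_sub, Real.sin_arctan]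
    field_simp
  · rw [Real.sin_pi_div_two_sub, Real.cos_arctan]
    field_simp

theorem support_superposition_subset_verticalCone :
    Function.support (superposition discCoeff discRadius discCenter bump) ⊆ verticalCone := by
  intro x hx
  obtain ⟨i, hi⟩ := exists_mem_disc_of_superposition_ne_zero hx
  have hpos : (0 : ℝ) < 99 / 100 * (1 / 2) ^ i.1 := by positivity
  exact mem_verticalCone_of_abs_le (hpos.trans_le (apply_one_mem_Icc_of_mem_disc hi).1)
    (abs_apply_zero_le_of_mem_disc hi)

theorem exists_mem_disc_of_mem_tsupport
    (hx : x ∈ tsupport (superposition discCoeff discRadius discCenter bump)) (h₀ : x 0 ≠ 0) :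
    ∃ i, x ∈ disc i := by
  have hpos : 0 < |x 0| := abs_pos.2 h₀
  -- Only the finitely many discs of `S` come close to `x`.
  let S : Set (ℕ × ℕ) := {i | |x 0| / 18 ≤ discRadius i}
  have hfin : S.Finite := by
    have := tendsto_discRadius_cofinite.eventually_lt_const (by positivity : 0 < |x 0| / 18)
    simpa only [not_lt] using eventually_cofinite.1 this
  have hclosed : IsClosed ({z : Plane | |z 0| ≤ |x 0| / 2} ∪ ⋃ i ∈ S, disc i) :=
    (isClosed_le (by fun_prop) continuous_const).union
      (hfin.isClosed_biUnion fun i _ => Metric.isClosed_closedBall)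
  have hsub : Function.support (superposition discCoeff discRadius discCenter bump) ⊆
      {z : Plane | |z 0| ≤ |x 0| / 2} ∪ ⋃ i ∈ S, disc i := by
    intro z hz
    obtain ⟨i, hi⟩ := exists_mem_disc_of_superposition_ne_zero hz
    by_cases hiS : i ∈ S
    · exact .inr (Set.mem_biUnion hiS hi)
    · have hr : discRadius i < |x 0| / 18 := not_le.1 hiS
      have hz₀ := apply_zero_mem_Icc_of_mem_disc hi
      have hrpos := discRadius_pos i
      have hz : |z 0| ≤ |x 0| / 2 := abs_le.2 ⟨by linarith [hz₀.1], by linarith [hz₀.2]⟩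
      exact .inl hz
  rcases closure_minimal hsub hclosed hx with h | h
  · exact absurd (h : |x 0| ≤ |x 0| / 2) (not_le.2 (half_lt_self hpos))
  · obtain ⟨i, -, hi⟩ := Set.mem_iUnion₂.1 h
    exact ⟨i, hi⟩

theorem ae_apply_ne_zero : ∀ᵐ x : Plane, x 0 ≠ 0 := by
  let L : Submodule ℝ Plane := LinearMap.ker (EuclideanSpace.proj (𝕜 := ℝ) (0 : Fin 2)).toLinearMap
  have hL : L ≠ ⊤ := fun h => by
    have : EuclideanSpace.single 0 1 ∈ L := h ▸ Submodule.mem_top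
    simp [L] at this
  exact measure_mono_null (fun x hx => by simpa [L] using hx)
    (Measure.addHaar_submodule volume L hL)

theorem ae_superposition_bumpResponse_nonneg : ∀ᵐ x : Plane,
    x ∈ tsupport (superposition discCoeff discRadius discCenter bump) →
      0 ≤ superposition discCoeff discRadius discCenter bumpResponse x := by
  obtain ⟨p, hp, hp_two, hs⟩ := exists_summable_discCoeff_mul_discRadius_rpow
  filter_upwards [ae_apply_ne_zero, ae_summable_rescale hp.le hp_two.ne_top
    (memLp_bumpResponse hp) discCoeff_nonneg discRadius_pos (y := discCenter) (by simpa using hs)]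
    with x hx₀ hsum hx
  obtain ⟨⟨n, k⟩, hi⟩ := exists_mem_disc_of_mem_tsupport hx hx₀
  exact tsum_discResponse_nonneg hsum hi

theorem memLp_superposition_bump {p : ℝ≥0∞} (hp : 1 ≤ p) (hp_top : p ≠ ∞)
    (hs : Summable fun i => discCoeff i * discRadius i ^ (2 / p.toReal)) :
    MemLp (superposition discCoeff discRadius discCenter bump) p volume :=
  memLp_superposition hp hp_top (memLp_bump p) discCoeff_nonneg discRadius_pos (by simpa using hs)

theorem integrable_superposition_bump :
    Integrable (superposition discCoeff discRadius discCenter bump) :=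
  memLp_one_iff_integrable.1 (memLp_superposition_bump le_rfl ENNReal.one_ne_top
    (by simpa using summable_discCoeff_mul_discRadius_sq))

theorem not_memLp_two_superposition_bump_ball {δ : ℝ} (hδ : 0 < δ) :
    ¬ MemLp (superposition discCoeff discRadius discCenter bump) 2
      (volume.restrict (Metric.ball 0 δ)) := by
  obtain ⟨n, hn⟩ := exists_pow_lt_of_lt_one (half_pos hδ) (one_half_lt_one (α := ℝ))
  have hdisc (k : ℕ) : disc (n, k) ⊆ Metric.ball 0 δ := fun x hx =>
    mem_ball_zero_iff.2 ((norm_le_of_mem_disc hx).trans_lt (by simp only; linarith))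
  exact not_memLp_superposition le_rfl ENNReal.one_ne_top (memLp_bump 1) bump_nonneg
    discCoeff_nonneg discRadius_pos (by simpa using summable_discCoeff_mul_discRadius_sq)
    ENNReal.ofNat_ne_top (eLpNorm_bump_ne_zero two_ne_zero)
    (fun k x hx => bump_rescale_eq_zero_of_notMem_disc fun h => hx (hdisc k h))
    (by simpa using tendsto_discCoeff_mul_discRadius_atTop n)

end Location

end RieszSquare

end

open RieszSquare

theorem theorem3p2 :
    -- `R₁²` is a (bounded) negative operator on `L²`
    (∃ A : Lp ℂ 2 (volume : Measure RieszSquare.Plane) →L[ℂ]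
          Lp ℂ 2 (volume : Measure RieszSquare.Plane),
        (∀ f : Lp ℂ 2 (volume : Measure RieszSquare.Plane), RieszSquare.IsRieszOneSq f (A f)) ∧ (-A).IsPositive) ∧
    ∃ W g : RieszSquare.Plane → ℝ,
      Integrable W volume ∧
      (∀ x, 0 ≤ W x) ∧
      ¬ (W =ᵐ[volume] 0) ∧
      -- `g = R₁² W`, and it is non-negative on the (closed) support of `W`
      RieszSquare.IsRieszOneSq (fun x => (W x : ℂ)) (fun x => (g x : ℂ)) ∧
      (∀ᵐ x ∂volume, x ∈ tsupport W → 0 ≤ g x) ∧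
      -- `W` is not in `L²`, but lies in some `Lᵖ` with `1 < p < 2`
      ¬ MemLp W 2 volume ∧
      (∃ p : ℝ≥0∞, 1 < p ∧ p < 2 ∧ MemLp W p volume) ∧
      -- `W` lives in the cone around `θ = π/2`
      Function.support W ⊆ RieszSquare.verticalCone ∧
      -- `W` is singular at the origin: not square integrable in any neighbourhood of it
      (∀ δ : ℝ, 0 < δ → ¬ MemLp W 2 (volume.restrict (Metric.ball 0 δ))) := by
  have hL2 (δ : ℝ) (hδ : 0 < δ) := not_memLp_two_superposition_bump_ball hδ
  have hL2_univ : ¬ MemLp (superposition discCoeff discRadius discCenter bump) 2 volume :=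
    fun h => hL2 1 one_pos (h.restrict _)
  obtain ⟨p, hp, hp_two, hs⟩ := exists_summable_discCoeff_mul_discRadius_rpow
  exact ⟨⟨rieszOneSqL2, isRieszOneSq_rieszOneSqL2, isPositive_neg_rieszOneSqL2⟩,
    superposition discCoeff discRadius discCenter bump,
    superposition discCoeff discRadius discCenter bumpResponse,
    integrable_superposition_bump,
    superposition_bump_nonneg,
    fun h => hL2_univ ((memLp_congr_ae h).2 MemLp.zero'),
    isRieszOneSq_superposition hp hp_two.ne_top discCoeff_nonneg discRadius_pos
      summable_discCoeff_mul_discRadius_sq hs,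
    ae_superposition_bumpResponse_nonneg,
    hL2_univ,
    ⟨p, hp, hp_two, memLp_superposition_bump hp.le hp_two.ne_top hs⟩,
    support_superposition_subset_verticalCone,
    hL2⟩
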